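/- Let $G$ be a countable discrete group with identity $e$, let $n\ge 0$ be an integer, and let $f\in M_n(\mathbb{C}(G))$, where $\mathbb{C}(G)$ is the complex group ring. For $a=\sum_{h}a(h)h\in\mathbb{C}(G)$ and $\zeta\in\ell^2(G)$ put $$(\lambda(a)\zeta)(g)=\sum_{h\in G}a(h)\,\zeta(h^{-1}g),\qquad (r(a)\zeta)(g)=\sum_{h\in G}\zeta(h)\,a(h^{-1}g).$$ Let $\lambda(f)$ be the bounded operator on $\ell^2(G)^{\oplus n}$ given by $(\lambda(f)\zeta)(l)=\sum_{k=1}^n\lambda(f_{lk})\zeta(k)$. For $\xi\in M_n(\ell^2(G))$ define $\lambda(f)\xi,\ \xi\lambda(f)\in M_n(\ell^2(G))$ by $$(\lambda(f)\xi)_{ij}=\sum_{k=1}^n\lambda(f_{ik})\xi_{kj},\qquad (\xi\lambda(f))_{ij}=\sum_{k=1}^n r(f_{kj})\xi_{ik},$$ and let $\delta_e\otimes\mathrm{id}\in M_n(\ell^2(G))$ be the matrix with $\delta_e$ on the diagonal and $0$ elsewhere. Suppose that $\xi\in M_n(\ell^2(G))$ satisfies $\lambda(f)\xi=\delta_e\otimes\mathrm{id}$.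 Then: 1. $\lambda(f)$ is injective as an operator $\ell^2(G)^{\oplus n}\to\ell^2(G)^{\oplus n}$; 2. the map $M_n(\ell^2(G))\to M_n(\ell^2(G))$, $\zeta\mapsto\lambda(f)\zeta$, is injective; 3. $\xi\lambda(f)=\delta_e\otimes\mathrm{id}$; 4. $\xi$ is unique: if $\eta\in M_n(\ell^2(G))$ satisfies $\lambda(f)\eta=\delta_e\otimes\mathrm{id}$ or $\eta\lambda(f)=\delta_e\otimes\mathrm{id}$, then $\eta=\xi$; 5. if $f\in M_n(\mathbb{Z}(G))$, then $\xi\in M_n(\ell^2(G,\mathbb{R}))$, i.e. all entries of $\xi$ are real-valued. Conversely to 3, if $\xi\in M_n(\ell^2(G))$ satisfies $\xi\lambda(f)=\delta_e\otimes\mathrm{id}$, then $\lambda(f)\xi=\delta_e\otimes\mathrm{id}$. -/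

import Mathlib

open scoped ENNReal

noncomputable section

namespace L2FormalInverse

/-- The complex Hilbert space `ℓ²(G)`. -/
abbrev Ell2 (G : Type*) := lp (fun _ : G => ℂ) 2

/-- The real Hilbert space `ℓ²(G, ℝ)`. -/
abbrev Ell2Real (G : Type*) := lp (fun _ : G => ℝ) 2

/-- `ℓ²(G)^{⊕n}`, with its Hilbert space norm. -/
abbrev Ell2Vec (G : Type*) (n : ℕ) := PiLp 2 (fun _ : Fin n => Ell2 G)

/-- `M_n(ℓ²(G))`. -/
abbrev Ell2Mat (G : Type*) (n : ℕ) := Matrix (Fin n) (Fin n) (Ell2 G)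

/-- Composition with a permutation of the index set, as an isometry of `ℓ²`. -/
def reindex {G : Type*} (e : Equiv.Perm G) : Ell2 G →ₗᵢ[ℂ] Ell2 G where
  toFun ξ := ⟨fun g => ξ (e g), memℓp_gen
    ((e.summable_iff (f := fun g => ‖ξ g‖ ^ (2 : ℝ≥0∞).toReal)).2
      ((lp.memℓp ξ).summable (by norm_num)))⟩
  map_add' ξ η := by ext g; rfl
  map_smul' c ξ := by ext g; rfl
  norm_map' ξ := by
    rw [lp.norm_eq_tsum_rpow (by norm_num), lp.norm_eq_tsum_rpow (by norm_num)]
    congr 1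
    exact e.tsum_eq (fun g => ‖ξ g‖ ^ (2 : ℝ≥0∞).toReal)

@[simp] theorem reindex_apply {G : Type*} (e : Equiv.Perm G) (ξ : Ell2 G) (g : G) :
    reindex e ξ g = ξ (e g) := rfl

variable {G : Type*} [Group G]

/-- Left translation `(λ(h) ξ)(g) = ξ(h⁻¹ g)` on `ℓ²(G)`. -/
def leftTranslation (h : G) : Ell2 G →ₗᵢ[ℂ] Ell2 G := reindex (Equiv.mulLeft h⁻¹)

/-- Right translation `(r(h) ξ)(g) = ξ(g h⁻¹)` on `ℓ²(G)`. -/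
def rightTranslation (h : G) : Ell2 G →ₗᵢ[ℂ] Ell2 G := reindex (Equiv.mulRight h⁻¹)

/-- The bounded operator `λ(a)` of left convolution by `a ∈ ℂ(G)` on `ℓ²(G)`. -/
def lam (a : MonoidAlgebra ℂ G) : Ell2 G →L[ℂ] Ell2 G :=
  a.coeff.sum fun h c => c • (leftTranslation h).toContinuousLinearMap

/-- The bounded operator `r(a)` of right convolution by `a ∈ ℂ(G)` on `ℓ²(G)`. -/
def rho (a : MonoidAlgebra ℂ G) : Ell2 G →L[ℂ] Ell2 G :=
  a.coeff.sum fun h c => c • (rightTranslation h).toContinuousLinearMap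

/-- `(λ(a) ξ)(g) = ∑_h a(h) ξ(h⁻¹ g)`, a finite sum over the support of `a`. -/
theorem lam_apply (a : MonoidAlgebra ℂ G) (ξ : Ell2 G) (g : G) :
    lam a ξ g = ∑ h ∈ a.coeff.support, a.coeff h * ξ (h⁻¹ * g) := by
  simp only [lam, Finsupp.sum, sum_apply, lp.coeFn_sum, Finset.sum_apply]
  rfl

/-- `(r(a) ξ)(g) = ∑_h a(h) ξ(g h⁻¹)`, a finite sum over the support of `a`. -/
theorem rho_apply (a : MonoidAlgebra ℂ G) (ξ : Ell2 G) (g : G) :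
    rho a ξ g = ∑ h ∈ a.coeff.support, a.coeff h * ξ (g * h⁻¹) := by
  simp only [rho, Finsupp.sum, sum_apply, lp.coeFn_sum, Finset.sum_apply]
  rfl

/-- The same operator in the form `(r(a) ξ)(g) = ∑_h ξ(h) a(h⁻¹ g)`. -/
theorem rho_apply_eq_tsum (a : MonoidAlgebra ℂ G) (ξ : Ell2 G) (g : G) :
    rho a ξ g = ∑' h : G, ξ h * a.coeff (h⁻¹ * g) := by
  rw [rho_apply, ← ((Equiv.inv G).trans (Equiv.mulLeft g)).tsum_eq, tsum_eq_sum]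
  · refine Finset.sum_congr rfl fun h _ => ?_
    simp [mul_comm]
  · intro h hh
    simpa using Or.inr hh

/-- The bounded operator `λ(f)` on `ℓ²(G)^{⊕n}` for `f ∈ M_n(ℂ(G))`:
`(λ(f) ζ)(l) = ∑_k λ(f_{lk}) ζ(k)`. -/
def lamVec {n : ℕ} (f : Matrix (Fin n) (Fin n) (MonoidAlgebra ℂ G)) :
    Ell2Vec G n →L[ℂ] Ell2Vec G n :=
  (PiLp.continuousLinearEquiv 2 ℂ (fun _ : Fin n => Ell2 G)).symm.toContinuousLinearMap ∘L
    ContinuousLinearMap.pi fun l =>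
      ∑ k, lam (f l k) ∘L PiLp.proj 2 (fun _ : Fin n => Ell2 G) k

theorem lamVec_apply {n : ℕ} (f : Matrix (Fin n) (Fin n) (MonoidAlgebra ℂ G))
    (ζ : Ell2Vec G n) (l : Fin n) : lamVec f ζ l = ∑ k, lam (f l k) (ζ k) := by
  simp [lamVec]

/-- The product `λ(f) ξ ∈ M_n(ℓ²(G))`: `(λ(f) ξ)_{ij} = ∑_k λ(f_{ik}) ξ_{kj}`. -/
def leftMul {n : ℕ} (f : Matrix (Fin n) (Fin n) (MonoidAlgebra ℂ G)) (ξ : Ell2Mat G n) :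
    Ell2Mat G n :=
  Matrix.of fun i j => ∑ k, lam (f i k) (ξ k j)

/-- The product `ξ λ(f) ∈ M_n(ℓ²(G))`: `(ξ λ(f))_{ij} = ∑_k r(f_{kj}) ξ_{ik}`. -/
def rightMul {n : ℕ} (ξ : Ell2Mat G n) (f : Matrix (Fin n) (Fin n) (MonoidAlgebra ℂ G)) :
    Ell2Mat G n :=
  Matrix.of fun i j => ∑ k, rho (f k j) (ξ i k)

variable (G) in
open Classical in
/-- `δ_e ∈ ℓ²(G)`, the indicator function of the identity. -/
def deltaOne : Ell2 G := lp.single 2 (1 : G) (1 : ℂ)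

variable (G) in
/-- `δ_e ⊗ id ∈ M_n(ℓ²(G))`: `δ_e` on the diagonal and `0` elsewhere. -/
def deltaId (n : ℕ) : Ell2Mat G n := Matrix.diagonal fun _ => deltaOne G

/-- The inclusion `M_n(ℤ(G)) ⊆ M_n(ℂ(G))`. -/
def ofInt {n : ℕ} (f : Matrix (Fin n) (Fin n) (MonoidAlgebra ℤ G)) :
    Matrix (Fin n) (Fin n) (MonoidAlgebra ℂ G) :=
  f.map (MonoidAlgebra.mapRingHom G (Int.castRingHom ℂ))

/-- `ξ ∈ M_n(ℓ²(G, ℝ))`, viewed inside `M_n(ℓ²(G))`. -/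
def IsRealMat {n : ℕ} (ξ : Ell2Mat G n) : Prop :=
  ∃ η : Matrix (Fin n) (Fin n) (Ell2Real G), ∀ i j g, ξ i j g = ((η i j g : ℝ) : ℂ)

end L2FormalInverse

end

open scoped InnerProductSpace
open Filter Topology

/-! The heart is that the algebra of operators commuting with right translations is finite. For `T =
lamVec f`, the columns of `ξ` put every basis vector `e_j = deltaVec G j` in the range of `T`, and
this must force `ker T = 0`. Instead of kernel projections, powers of `S = 1 - c⁻¹ T†T` and `S' = 1
- c⁻¹ T T†` are compared. Since `T S^k = S'^k T` and `T S^k x → 0`, also `S'^k e_j → 0`. The trace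
property gives `∑ ‖S^k e_j‖² = ∑ ‖S'^k e_j‖²`, so `S^k e_j → 0`. But `S^k` fixes `ker T`, hence
`e_j` is orthogonal to `ker T`; translation invariance then kills every coordinate. Cancelling
`λ(f)` yields the two-sided inverse, uniqueness and reality; inversion of `G` with transposition
yields the converse. -/

/-! ### Iterates of `1 - c⁻¹ T†T` -/

section HilbertSpace

variable {H : Type*} [NormedAddCommGroup H] [InnerProductSpace ℂ H] [CompleteSpace H]

/-- The contraction `1 - c⁻¹ T†T`, for `c ≥ ‖T‖²`. -/
noncomputable def defectOp (c : ℝ) (T : H →L[ℂ] H) : H →L[ℂ] H :=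
  1 - (c : ℂ)⁻¹ • (star T * T)

theorem isSelfAdjoint_defectOp (c : ℝ) (T : H →L[ℂ] H) : IsSelfAdjoint (defectOp c T) := by
  simp [IsSelfAdjoint, defectOp]

theorem mul_defectOp (c : ℝ) (T : H →L[ℂ] H) :
    T * defectOp c T = defectOp c (star T) * T := by
  simp [defectOp, mul_sub, sub_mul, mul_assoc]

theorem mul_defectOp_pow (c : ℝ) (T : H →L[ℂ] H) (k : ℕ) :
    T * defectOp c T ^ k = defectOp c (star T) ^ k * T := by
  have h : SemiconjBy T (defectOp c T) (defectOp c (star T)) := mul_defectOp c T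
  exact h.pow_right k

/-- Expanding the square, the cross term contributes `-2 c⁻¹ ‖T u‖²` and the quadratic term at most
`c⁻¹ ‖T u‖²`. -/
theorem norm_sq_defectOp_le {c : ℝ} (hc : 0 < c) {T : H →L[ℂ] H} (hT : ‖T‖ ^ 2 ≤ c) (u : H) :
    ‖defectOp c T u‖ ^ 2 ≤ ‖u‖ ^ 2 - c⁻¹ * ‖T u‖ ^ 2 := by
  have hinner : ⟪u, star T (T u)⟫_ℂ = ((‖T u‖ ^ 2 : ℝ) : ℂ) := by
    rw [ContinuousLinearMap.star_eq_adjoint, ContinuousLinearMap.adjoint_inner_right,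
      inner_self_eq_norm_sq_to_K]
    simp
  have hnorm : ‖star T (T u)‖ ^ 2 ≤ c * ‖T u‖ ^ 2 := by
    have h := (star T).le_opNorm (T u)
    rw [norm_star] at h
    calc ‖star T (T u)‖ ^ 2 ≤ (‖T‖ * ‖T u‖) ^ 2 := by gcongr
      _ = ‖T‖ ^ 2 * ‖T u‖ ^ 2 := by ring
      _ ≤ c * ‖T u‖ ^ 2 := by gcongr
  have happ : defectOp c T u = u - ((c⁻¹ : ℝ) : ℂ) • star T (T u) := by
    simp [defectOp]
  have hci : ‖((c⁻¹ : ℝ) : ℂ)‖ = c⁻¹ := by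
    rw [Complex.norm_real, Real.norm_of_nonneg (by positivity)]
  rw [happ, norm_sub_sq (𝕜 := ℂ), inner_smul_right, hinner, norm_smul, hci, mul_pow,
    ← Complex.ofReal_mul]
  have h2 : (c⁻¹) ^ 2 * ‖star T (T u)‖ ^ 2 ≤ c⁻¹ * ‖T u‖ ^ 2 := by
    calc (c⁻¹) ^ 2 * ‖star T (T u)‖ ^ 2 ≤ (c⁻¹) ^ 2 * (c * ‖T u‖ ^ 2) := by gcongr
      _ = c⁻¹ * ‖T u‖ ^ 2 := by field_simp
  have h3 : RCLike.re ((c⁻¹ * ‖T u‖ ^ 2 : ℝ) : ℂ) = c⁻¹ * ‖T u‖ ^ 2 := Complex.ofReal_re _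
  rw [h3]
  linarith

/-- The squared norms of the iterates decrease to a limit, so their successive drops, which dominate
`c⁻¹ ‖T (S^k x)‖²`, tend to zero. -/
theorem tendsto_apply_defectOp_pow {c : ℝ} (hc : 0 < c) {T : H →L[ℂ] H} (hT : ‖T‖ ^ 2 ≤ c)
    (x : H) : Tendsto (fun k => T ((defectOp c T ^ k) x)) atTop (𝓝 0) := by
  set a : ℕ → ℝ := fun k => ‖(defectOp c T ^ k) x‖ ^ 2 with ha
  have hstep : ∀ k, a (k + 1) ≤ a k - c⁻¹ * ‖T ((defectOp c T ^ k) x)‖ ^ 2 := fun k => by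
    have h := norm_sq_defectOp_le hc hT ((defectOp c T ^ k) x)
    rw [← ContinuousLinearMap.comp_apply, ← ContinuousLinearMap.mul_def, ← pow_succ'] at h
    exact h
  have hanti : Antitone a := antitone_nat_of_succ_le fun k => by
    have := hstep k
    have h0 : 0 ≤ c⁻¹ * ‖T ((defectOp c T ^ k) x)‖ ^ 2 := by positivity
    linarith
  have hlim := tendsto_atTop_ciInf hanti ⟨0, by rintro _ ⟨k, rfl⟩; positivity⟩
  have hdiff : Tendsto (fun k => c * (a k - a (k + 1))) atTop (𝓝 0) := by
    simpa using (hlim.sub (hlim.comp (tendsto_add_atTop_nat 1))).const_mul c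
  have hsq : Tendsto (fun k => ‖T ((defectOp c T ^ k) x)‖ ^ 2) atTop (𝓝 0) := by
    refine squeeze_zero (fun k => by positivity) (fun k => ?_) hdiff
    calc ‖T ((defectOp c T ^ k) x)‖ ^ 2 = c * (c⁻¹ * ‖T ((defectOp c T ^ k) x)‖ ^ 2) := by
          field_simp
      _ ≤ c * (a k - a (k + 1)) := by
          have := hstep k
          gcongr
          linarith
  rw [tendsto_zero_iff_norm_tendsto_zero]
  have h := hsq.sqrt
  simpa using h

theorem defectOp_pow_apply_of_apply_eq_zero (c : ℝ) {T : H →L[ℂ] H} {x : H} (hx : T x = 0)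
    (k : ℕ) : (defectOp c T ^ k) x = x := by
  induction k with
  | zero => simp
  | succ k ih =>
    rw [pow_succ, ContinuousLinearMap.mul_def, ContinuousLinearMap.comp_apply]
    simpa [defectOp, hx] using ih

end HilbertSpace

namespace L2FormalInverse

variable {G : Type*} [Group G] {n : ℕ}

/-! ### The commutant of the right translations and its trace -/

omit [Group G] in
theorem ell2_inner_eq_tsum (x y : Ell2 G) : ⟪x, y⟫_ℂ = ∑' g, y g * star (x g) := by
  rw [lp.inner_eq_tsum]
  rfl

theorem inner_deltaOne_left (x : Ell2 G) : ⟪deltaOne G, x⟫_ℂ = x 1 := by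
  classical
  rw [deltaOne, lp.inner_single_left]
  simp

theorem deltaOne_apply_one : deltaOne G (1 : G) = 1 := by
  simp [deltaOne]

theorem deltaOne_apply_of_ne {g : G} (hg : g ≠ 1) : deltaOne G g = 0 := by
  simp [deltaOne, hg]

theorem rightTranslation_apply (h : G) (x : Ell2 G) (g : G) :
    rightTranslation h x g = x (g * h⁻¹) := rfl

/-- Right translation on `ℓ²(G)^{⊕n}`. -/
noncomputable def rightTranslationVec (n : ℕ) (h : G) : Ell2Vec G n →L[ℂ] Ell2Vec G n :=
  (PiLp.continuousLinearEquiv 2 ℂ (fun _ : Fin n => Ell2 G)).symm.toContinuousLinearMap ∘L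
    ContinuousLinearMap.pi fun l =>
      (rightTranslation h).toContinuousLinearMap ∘L PiLp.proj 2 (fun _ : Fin n => Ell2 G) l

theorem rightTranslationVec_apply (h : G) (x : Ell2Vec G n) (i : Fin n) (g : G) :
    rightTranslationVec n h x i g = x i (g * h⁻¹) := rfl

theorem star_rightTranslationVec (h : G) :
    star (rightTranslationVec n h) = rightTranslationVec n h⁻¹ := by
  rw [ContinuousLinearMap.star_eq_adjoint, eq_comm, ContinuousLinearMap.eq_adjoint_iff]
  intro x y
  simp only [PiLp.inner_apply, ell2_inner_eq_tsum]
  refine Finset.sum_congr rfl fun i _ => ?_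
  rw [← (Equiv.mulRight h⁻¹).tsum_eq]
  simp [rightTranslationVec_apply]

/-- The vector with `δ_e` in position `j` and `0` elsewhere. -/
noncomputable def deltaVec (G : Type*) [Group G] (j : Fin n) : Ell2Vec G n :=
  WithLp.toLp 2 (Pi.single j (deltaOne G))

theorem inner_deltaVec_left (j : Fin n) (x : Ell2Vec G n) : ⟪deltaVec G j, x⟫_ℂ = x j 1 := by
  rw [PiLp.inner_apply, Finset.sum_eq_single j]
  · simp [deltaVec, inner_deltaOne_left]
  · intro i _ hi
    simp [deltaVec, hi]
  · simp

/-- The operators on `ℓ²(G)^{⊕n}` commuting with all right translations. -/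
def CommutesRight (A : Ell2Vec G n →L[ℂ] Ell2Vec G n) : Prop :=
  ∀ g : G, Commute A (rightTranslationVec n g)

theorem CommutesRight.star {A : Ell2Vec G n →L[ℂ] Ell2Vec G n} (hA : CommutesRight A) :
    CommutesRight (star A) := fun g => by
  have h := (hA g⁻¹).star_star
  rwa [star_rightTranslationVec, inv_inv] at h

theorem CommutesRight.mul {A B : Ell2Vec G n →L[ℂ] Ell2Vec G n} (hA : CommutesRight A)
    (hB : CommutesRight B) : CommutesRight (A * B) := fun g => (hA g).mul_left (hB g)

theorem CommutesRight.defectOp_pow {A : Ell2Vec G n →L[ℂ] Ell2Vec G n} (hA : CommutesRight A)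
    (c : ℝ) (k : ℕ) : CommutesRight (defectOp c A ^ k) := fun g => by
  refine Commute.pow_left ?_ k
  exact (Commute.one_left _).sub_left ((hA.star.mul hA g).smul_left _)

theorem CommutesRight.apply {A : Ell2Vec G n →L[ℂ] Ell2Vec G n} (hA : CommutesRight A) (g : G)
    (x : Ell2Vec G n) : A (rightTranslationVec n g x) = rightTranslationVec n g (A x) :=
  DFunLike.congr_fun (hA g) x

/-- Evaluation at `g` is evaluation at the identity after a translation, and the translation passes
through `A` to the other side of the inner product. -/
theorem CommutesRight.star_apply_deltaVec {A : Ell2Vec G n →L[ℂ] Ell2Vec G n}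
    (hA : CommutesRight A) (i j : Fin n) (g : G) :
    (Star.star A) (deltaVec G j) i g = Star.star (A (deltaVec G i) j g⁻¹) := by
  have h1 : (Star.star A) (deltaVec G j) i g
      = ⟪deltaVec G i, rightTranslationVec n g⁻¹ ((Star.star A) (deltaVec G j))⟫_ℂ := by
    rw [inner_deltaVec_left, rightTranslationVec_apply]
    simp
  have h2 : A (deltaVec G i) j g⁻¹
      = ⟪deltaVec G j, rightTranslationVec n g (A (deltaVec G i))⟫_ℂ := by
    rw [inner_deltaVec_left, rightTranslationVec_apply]
    simp
  rw [h1, h2, ← hA.star.apply, ContinuousLinearMap.star_eq_adjoint,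
    ContinuousLinearMap.adjoint_inner_right, ← inv_inv g, ← star_rightTranslationVec g⁻¹,
    ContinuousLinearMap.star_eq_adjoint, ContinuousLinearMap.adjoint_inner_right, inv_inv]
  exact (inner_conj_symm _ _).symm

/-- The von Neumann trace `∑_j ⟨e_j, A e_j⟩`. -/
noncomputable def vnTrace (A : Ell2Vec G n →L[ℂ] Ell2Vec G n) : ℂ :=
  ∑ j, ⟪deltaVec G j, A (deltaVec G j)⟫_ℂ

/-- Both sides are the Hilbert–Schmidt pairing of the kernels of `A` and `B`; passing to adjoints
only swaps `i`, `j` and inverts `g`. Only finite sums are interchanged. -/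
theorem vnTrace_star_mul_comm {A B : Ell2Vec G n →L[ℂ] Ell2Vec G n} (hA : CommutesRight A)
    (hB : CommutesRight B) : vnTrace (star A * B) = vnTrace (B * star A) := by
  have hL : vnTrace (star A * B)
      = ∑ j, ∑ i, ∑' g, B (deltaVec G j) i g * star (A (deltaVec G j) i g) := by
    refine Finset.sum_congr rfl fun j _ => ?_
    rw [ContinuousLinearMap.mul_def, ContinuousLinearMap.comp_apply, ContinuousLinearMap.star_eq_adjoint,
      ContinuousLinearMap.adjoint_inner_right, PiLp.inner_apply]
    exact Finset.sum_congr rfl fun i _ => ell2_inner_eq_tsum _ _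
  have hR : vnTrace (B * star A)
      = ∑ j, ∑ i, ∑' g, B (deltaVec G i) j g * star (A (deltaVec G i) j g) := by
    refine Finset.sum_congr rfl fun j _ => ?_
    rw [ContinuousLinearMap.mul_def, ContinuousLinearMap.comp_apply, ← ContinuousLinearMap.adjoint_inner_left,
      ← ContinuousLinearMap.star_eq_adjoint, PiLp.inner_apply]
    refine Finset.sum_congr rfl fun i _ => ?_
    rw [ell2_inner_eq_tsum, ← (Equiv.inv G).tsum_eq]
    refine tsum_congr fun g => ?_
    simp only [hA.star_apply_deltaVec, hB.star_apply_deltaVec, Equiv.inv_apply, inv_inv, star_star]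
    exact mul_comm _ _
  rw [hL, hR, Finset.sum_comm]

theorem vnTrace_sub (A B : Ell2Vec G n →L[ℂ] Ell2Vec G n) :
    vnTrace (A - B) = vnTrace A - vnTrace B := by
  simp [vnTrace]

theorem vnTrace_smul (c : ℂ) (A : Ell2Vec G n →L[ℂ] Ell2Vec G n) :
    vnTrace (c • A) = c * vnTrace A := by
  simp [vnTrace, Finset.mul_sum]

/-- In the inductive step the two powers change by multiples of `T† B` and `B T†`, with the same `B
= T S^k`. -/
theorem vnTrace_defectOp_pow {T : Ell2Vec G n →L[ℂ] Ell2Vec G n} (hT : CommutesRight T)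
    (c : ℝ) (k : ℕ) : vnTrace (defectOp c T ^ k) = vnTrace (defectOp c (star T) ^ k) := by
  induction k with
  | zero => simp
  | succ k ih =>
    have h1 : defectOp c T ^ (k + 1)
        = defectOp c T ^ k - (c : ℂ)⁻¹ • (star T * (T * defectOp c T ^ k)) := by
      rw [pow_succ']
      conv_lhs => enter [1]; rw [defectOp]
      rw [sub_mul, one_mul, smul_mul_assoc, mul_assoc]
    have h2 : defectOp c (star T) ^ (k + 1)
        = defectOp c (star T) ^ k - (c : ℂ)⁻¹ • ((T * defectOp c T ^ k) * star T) := by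
      rw [mul_defectOp_pow, pow_succ]
      conv_lhs => enter [2]; rw [defectOp]
      rw [mul_sub, mul_one, mul_smul_comm, mul_assoc, star_star]
    rw [h1, h2, vnTrace_sub, vnTrace_sub, vnTrace_smul, vnTrace_smul, ih,
      vnTrace_star_mul_comm hT (hT.mul (hT.defectOp_pow c k))]

theorem ofReal_sum_norm_sq_eq_vnTrace {S : Ell2Vec G n →L[ℂ] Ell2Vec G n}
    (hS : IsSelfAdjoint S) (k : ℕ) :
    ((∑ j, ‖(S ^ k) (deltaVec G j)‖ ^ 2 : ℝ) : ℂ) = vnTrace (S ^ (2 * k)) := by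
  rw [Complex.ofReal_sum]
  refine Finset.sum_congr rfl fun j _ => ?_
  rw [two_mul, pow_add, ContinuousLinearMap.mul_def, ContinuousLinearMap.comp_apply, ← ContinuousLinearMap.adjoint_inner_left,
    ← ContinuousLinearMap.star_eq_adjoint, (hS.pow k).star_eq, inner_self_eq_norm_sq_to_K]
  simp

theorem CommutesRight.injective_of_deltaVec_mem_range {T : Ell2Vec G n →L[ℂ] Ell2Vec G n}
    (hT : CommutesRight T) (hrange : ∀ j, ∃ x, T x = deltaVec G j) : Function.Injective T := by
  -- The added `1` keeps `c` positive even when `T = 0`.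
  set c : ℝ := ‖T‖ ^ 2 + 1
  have hc : 0 < c := by positivity
  have hTc : ‖T‖ ^ 2 ≤ c := by simp [c]
  have hstar : ∀ j, Tendsto (fun k => (defectOp c (Star.star T) ^ k) (deltaVec G j)) atTop (𝓝 0) := by
    intro j
    obtain ⟨x, hx⟩ := hrange j
    refine (tendsto_apply_defectOp_pow hc hTc x).congr fun k => ?_
    rw [← hx]
    exact DFunLike.congr_fun (mul_defectOp_pow c T k) x
  have hsum : ∀ k, ∑ j, ‖(defectOp c T ^ k) (deltaVec G j)‖ ^ 2
      = ∑ j, ‖(defectOp c (Star.star T) ^ k) (deltaVec G j)‖ ^ 2 := by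
    intro k
    apply Complex.ofReal_injective
    rw [ofReal_sum_norm_sq_eq_vnTrace (isSelfAdjoint_defectOp c T),
      ofReal_sum_norm_sq_eq_vnTrace (isSelfAdjoint_defectOp c (Star.star T)), vnTrace_defectOp_pow hT]
  have hsum0 : Tendsto (fun k => ∑ j, ‖(defectOp c T ^ k) (deltaVec G j)‖ ^ 2) atTop (𝓝 0) := by
    simp only [hsum]
    simpa using tendsto_finsetSum Finset.univ fun j _ => ((hstar j).norm.pow 2)
  have hlim : ∀ j, Tendsto (fun k => (defectOp c T ^ k) (deltaVec G j)) atTop (𝓝 0) := by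
    intro j
    have hsq : Tendsto (fun k => ‖(defectOp c T ^ k) (deltaVec G j)‖ ^ 2) atTop (𝓝 0) :=
      squeeze_zero (fun k => by positivity)
        (fun k => Finset.single_le_sum
          (f := fun j => ‖(defectOp c T ^ k) (deltaVec G j)‖ ^ 2)
          (fun i _ => by positivity) (Finset.mem_univ j)) hsum0
    rw [tendsto_zero_iff_norm_tendsto_zero]
    simpa using hsq.sqrt
  rw [injective_iff_map_eq_zero]
  intro x hx
  ext j g
  -- This translate stays in the kernel and carries coordinate `g` to the identity, where pairing
  -- with `e_j` reads it.
  set y := rightTranslationVec n g⁻¹ x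
  have hy : T y = 0 := by rw [hT.apply, hx, map_zero]
  have hconst : ∀ k, ⟪(defectOp c T ^ k) (deltaVec G j), y⟫_ℂ = x j g := by
    intro k
    rw [← ((isSelfAdjoint_defectOp c T).pow k).star_eq, ContinuousLinearMap.star_eq_adjoint,
      ContinuousLinearMap.adjoint_inner_left, defectOp_pow_apply_of_apply_eq_zero c hy,
      inner_deltaVec_left, rightTranslationVec_apply]
    simp
  have h := (hlim j).inner (tendsto_const_nhds (x := y)) (𝕜 := ℂ)
  simp only [hconst, inner_zero_left] at h
  exact tendsto_nhds_unique tendsto_const_nhds h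

/-! ### Convolution operators -/

theorem lam_rightTranslation (a : MonoidAlgebra ℂ G) (g : G) (x : Ell2 G) :
    lam a (rightTranslation g x) = rightTranslation g (lam a x) := by
  ext k
  simp [lam_apply, rightTranslation_apply, mul_assoc]

theorem commutesRight_lamVec (f : Matrix (Fin n) (Fin n) (MonoidAlgebra ℂ G)) :
    CommutesRight (lamVec f) := fun g => by
  ext x i k
  change lamVec f (rightTranslationVec n g x) i k = lamVec f x i (k * g⁻¹)
  rw [lamVec_apply, lamVec_apply, ← rightTranslation_apply, map_sum]
  simp only [← lam_rightTranslation]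
  rfl

theorem lam_rho_comm (a b : MonoidAlgebra ℂ G) (x : Ell2 G) :
    lam a (rho b x) = rho b (lam a x) := by
  ext k
  simp only [lam_apply, rho_apply, Finset.mul_sum]
  rw [Finset.sum_comm]
  refine Finset.sum_congr rfl fun h _ => Finset.sum_congr rfl fun h' _ => ?_
  rw [mul_assoc]
  ring

theorem rho_deltaOne (a : MonoidAlgebra ℂ G) : rho a (deltaOne G) = lam a (deltaOne G) := by
  ext k
  simp only [lam_apply, rho_apply]
  refine Finset.sum_congr rfl fun h _ => ?_
  by_cases hk : k = h
  · simp [hk]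
  · rw [deltaOne_apply_of_ne (by rwa [Ne, mul_inv_eq_one]),
      deltaOne_apply_of_ne (by rwa [Ne, inv_mul_eq_one, eq_comm])]

theorem leftMul_apply (f : Matrix (Fin n) (Fin n) (MonoidAlgebra ℂ G)) (ξ : Ell2Mat G n)
    (i j : Fin n) : leftMul f ξ i j = ∑ k, lam (f i k) (ξ k j) := rfl

theorem rightMul_apply (f : Matrix (Fin n) (Fin n) (MonoidAlgebra ℂ G)) (ξ : Ell2Mat G n)
    (i j : Fin n) : rightMul ξ f i j = ∑ k, rho (f k j) (ξ i k) := rfl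

theorem deltaId_apply (i j : Fin n) :
    deltaId G n i j = if i = j then deltaOne G else 0 := rfl

theorem leftMul_rightMul (f : Matrix (Fin n) (Fin n) (MonoidAlgebra ℂ G)) (ξ : Ell2Mat G n) :
    leftMul f (rightMul ξ f) = rightMul (leftMul f ξ) f := by
  refine Matrix.ext fun i j => ?_
  simp only [leftMul_apply, rightMul_apply, map_sum, lam_rho_comm]
  exact Finset.sum_comm

theorem rightMul_deltaId (f : Matrix (Fin n) (Fin n) (MonoidAlgebra ℂ G)) :
    rightMul (deltaId G n) f = leftMul f (deltaId G n) := by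
  refine Matrix.ext fun i j => ?_
  rw [leftMul_apply, rightMul_apply, Finset.sum_eq_single i, Finset.sum_eq_single j]
  · simp [deltaId_apply, rho_deltaOne]
  · intro k _ hk
    simp [deltaId_apply, hk]
  · simp
  · intro k _ hk
    simp [deltaId_apply, hk.symm]
  · simp

/-- The `j`-th column of a matrix over `ℓ²(G)`. -/
noncomputable def column (ξ : Ell2Mat G n) (j : Fin n) : Ell2Vec G n :=
  WithLp.toLp 2 fun i => ξ i j

theorem lamVec_column (f : Matrix (Fin n) (Fin n) (MonoidAlgebra ℂ G)) (ξ : Ell2Mat G n)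
    (j : Fin n) : lamVec f (column ξ j) = column (leftMul f ξ) j := by
  ext1 i
  rw [lamVec_apply]
  rfl

theorem column_deltaId (j : Fin n) : column (deltaId G n) j = deltaVec G j := by
  ext1 i
  simp [column, deltaVec, deltaId_apply]

theorem lamVec_injective {f : Matrix (Fin n) (Fin n) (MonoidAlgebra ℂ G)} {ξ : Ell2Mat G n}
    (h : leftMul f ξ = deltaId G n) : Function.Injective (lamVec f) :=
  (commutesRight_lamVec f).injective_of_deltaVec_mem_range fun j =>
    ⟨column ξ j, by rw [lamVec_column, h, column_deltaId]⟩

theorem leftMul_injective {f : Matrix (Fin n) (Fin n) (MonoidAlgebra ℂ G)}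
    (h : Function.Injective (lamVec f)) :
    Function.Injective (leftMul f : Ell2Mat G n → Ell2Mat G n) := by
  intro ξ η hξη
  refine Matrix.ext fun i j => ?_
  have hcol : column ξ j = column η j := h (by rw [lamVec_column, lamVec_column, hξη])
  exact congrArg (fun v : Ell2Vec G n => v i) hcol

/-- Left and right convolution commute, so `λ(f)(ξλ(f)) = (λ(f)ξ)λ(f) = λ(f)(δ_e ⊗ id)`, and `λ(f)`
cancels. -/
theorem rightMul_eq_deltaId {f : Matrix (Fin n) (Fin n) (MonoidAlgebra ℂ G)} {ξ : Ell2Mat G n}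
    (h : leftMul f ξ = deltaId G n) : rightMul ξ f = deltaId G n :=
  leftMul_injective (lamVec_injective h) (by rw [leftMul_rightMul, h, rightMul_deltaId])

/-! ### Exchanging left and right by inversion -/

/-- The element `∑_h a(h) h⁻¹`. -/
noncomputable def invert (a : MonoidAlgebra ℂ G) : MonoidAlgebra ℂ G :=
  MonoidAlgebra.ofCoeff (a.coeff.equivMapDomain (Equiv.inv G))

theorem lam_invert (a : MonoidAlgebra ℂ G) (x : Ell2 G) :
    lam (invert a) (reindex (Equiv.inv G) x) = reindex (Equiv.inv G) (rho a x) := by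
  ext g
  rw [lam_apply, reindex_apply, rho_apply]
  refine Finset.sum_bij' (fun h _ => h⁻¹) (fun h _ => h⁻¹) ?_ ?_ ?_ ?_ ?_ <;>
    simp [invert]

theorem rho_invert (a : MonoidAlgebra ℂ G) (x : Ell2 G) :
    rho (invert a) (reindex (Equiv.inv G) x) = reindex (Equiv.inv G) (lam a x) := by
  ext g
  rw [rho_apply, reindex_apply, lam_apply]
  refine Finset.sum_bij' (fun h _ => h⁻¹) (fun h _ => h⁻¹) ?_ ?_ ?_ ?_ ?_ <;>
    simp [invert]

/-- Transposition composed with inversion of the group variable. -/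
noncomputable def invertTranspose (ξ : Ell2Mat G n) : Ell2Mat G n :=
  Matrix.of fun i j => reindex (Equiv.inv G) (ξ j i)

theorem invertTranspose_involutive :
    Function.Involutive (invertTranspose : Ell2Mat G n → Ell2Mat G n) := by
  intro ξ
  ext i j g
  simp [invertTranspose]

theorem invertTranspose_deltaId : invertTranspose (deltaId G n) = deltaId G n := by
  ext i j g
  by_cases hij : i = j
  · subst hij
    by_cases hg : g = 1
    · simp [invertTranspose, deltaId_apply, hg]
    · simp [invertTranspose, deltaId_apply, deltaOne_apply_of_ne, hg]
  · simp [invertTranspose, deltaId_apply, hij, Ne.symm hij]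

/-- Inversion exchanges left and right convolution; transposition reverses the matrix product to
match. -/
theorem leftMul_invertTranspose (f : Matrix (Fin n) (Fin n) (MonoidAlgebra ℂ G))
    (ξ : Ell2Mat G n) :
    leftMul (f.map invert).transpose (invertTranspose ξ) = invertTranspose (rightMul ξ f) := by
  refine Matrix.ext fun i j => ?_
  simp [leftMul_apply, rightMul_apply, invertTranspose, lam_invert]

theorem rightMul_invertTranspose (f : Matrix (Fin n) (Fin n) (MonoidAlgebra ℂ G))
    (ξ : Ell2Mat G n) :
    rightMul (invertTranspose ξ) (f.map invert).transpose = invertTranspose (leftMul f ξ) := by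
  refine Matrix.ext fun i j => ?_
  simp [leftMul_apply, rightMul_apply, invertTranspose, rho_invert]

theorem leftMul_eq_deltaId {f : Matrix (Fin n) (Fin n) (MonoidAlgebra ℂ G)} {ξ : Ell2Mat G n}
    (h : rightMul ξ f = deltaId G n) : leftMul f ξ = deltaId G n := by
  have h1 : leftMul (f.map invert).transpose (invertTranspose ξ) = deltaId G n := by
    rw [leftMul_invertTranspose, h, invertTranspose_deltaId]
  have h2 := rightMul_eq_deltaId h1
  rw [rightMul_invertTranspose] at h2
  exact invertTranspose_involutive.injective (h2.trans invertTranspose_deltaId.symm)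

/-! ### Real group ring elements -/

theorem lam_star {a : MonoidAlgebra ℂ G} (ha : ∀ h, star (a.coeff h) = a.coeff h) (x : Ell2 G) :
    lam a (star x) = star (lam a x) := by
  ext g
  simp only [lam_apply, lp.star_apply, star_sum, star_mul', ha]

theorem star_deltaOne : star (deltaOne G) = deltaOne G := by
  ext g
  by_cases hg : g = 1
  · simp [hg, deltaOne_apply_one]
  · simp [deltaOne_apply_of_ne hg]

/-- Conjugation preserves the equation when the coefficients of `f` are real, so uniqueness will
force `ξ` to equal its conjugate. -/
theorem leftMul_map_star {f : Matrix (Fin n) (Fin n) (MonoidAlgebra ℂ G)}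
    (hf : ∀ i j h, star ((f i j).coeff h) = (f i j).coeff h) {ξ : Ell2Mat G n}
    (h : leftMul f ξ = deltaId G n) : leftMul f (ξ.map star) = deltaId G n := by
  refine Matrix.ext fun i j => ?_
  have hij := congrFun (congrFun h i) j
  rw [leftMul_apply] at hij ⊢
  simp only [Matrix.map_apply, lam_star (hf _ _), ← star_sum, hij]
  rw [deltaId_apply]
  split_ifs
  · exact star_deltaOne
  · exact star_zero _

omit [Group G] in
theorem isRealMat_of_map_star {ξ : Ell2Mat G n} (h : ξ.map star = ξ) : IsRealMat ξ := by
  have hmem : ∀ i j, Memℓp (fun g => (ξ i j g).re) 2 := fun i j =>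
    by
    refine memℓp_gen (((lp.memℓp (ξ i j)).summable (by norm_num)).of_nonneg_of_le
      (fun g => by positivity) fun g => ?_)
    gcongr
    exact Complex.abs_re_le_norm _
  refine ⟨Matrix.of fun i j => ⟨fun g => (ξ i j g).re, hmem i j⟩, fun i j g => ?_⟩
  have hij : star (ξ i j) = ξ i j := congrFun (congrFun h i) j
  have hg : star (ξ i j g) = ξ i j g := by rw [← lp.star_apply, hij]
  exact (Complex.conj_eq_iff_re.1 hg).symm

theorem star_coeff_ofInt (f₀ : Matrix (Fin n) (Fin n) (MonoidAlgebra ℤ G)) (i j : Fin n) (h : G) :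
    star ((ofInt f₀ i j).coeff h) = (ofInt f₀ i j).coeff h := by
  simp [ofInt]

end L2FormalInverse

open L2FormalInverse in
theorem proposition2p2 {G : Type*} [Group G] [Countable G] (n : ℕ)
    (f : Matrix (Fin n) (Fin n) (MonoidAlgebra ℂ G)) (ξ : L2FormalInverse.Ell2Mat G n) :
    (L2FormalInverse.leftMul f ξ = L2FormalInverse.deltaId G n →
      Function.Injective (L2FormalInverse.lamVec f) ∧
      Function.Injective
        (L2FormalInverse.leftMul f :
          L2FormalInverse.Ell2Mat G n → L2FormalInverse.Ell2Mat G n) ∧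
      L2FormalInverse.rightMul ξ f = L2FormalInverse.deltaId G n ∧
      (∀ η : L2FormalInverse.Ell2Mat G n,
        L2FormalInverse.leftMul f η = L2FormalInverse.deltaId G n ∨
          L2FormalInverse.rightMul η f = L2FormalInverse.deltaId G n → η = ξ) ∧
      (∀ f₀ : Matrix (Fin n) (Fin n) (MonoidAlgebra ℤ G),
        f = L2FormalInverse.ofInt f₀ → L2FormalInverse.IsRealMat ξ)) ∧
    (L2FormalInverse.rightMul ξ f = L2FormalInverse.deltaId G n →
      L2FormalInverse.leftMul f ξ = L2FormalInverse.deltaId G n) := by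
  refine ⟨fun h => ?_, leftMul_eq_deltaId⟩
  have hinj := leftMul_injective (lamVec_injective h)
  refine ⟨lamVec_injective h, hinj, rightMul_eq_deltaId h, ?_, ?_⟩
  · rintro η (hη | hη)
    · exact hinj (hη.trans h.symm)
    · exact hinj ((leftMul_eq_deltaId hη).trans h.symm)
  · rintro f₀ rfl
    exact isRealMat_of_map_star
      (hinj ((leftMul_map_star (star_coeff_ofInt f₀) h).trans h.symm))
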